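/- All Banach spaces are real and nonzero. For $i=1,2$ let $K_i$ be a compact Hausdorff space, $E_i$ a Banach space, and $\mathcal H_i$ a closed linear subspace of $\mathcal C(K_i,E_i)$, the space of continuous $E_i$-valued functions on $K_i$ with the supremum norm. For a closed subspace $\mathcal H\subseteq\mathcal C(K,E)$, let $\mathcal A\subseteq \mathcal C(K,\mathbb R)$ be the closed linear span of the functions $x\mapsto\langle e^*,h(x)\rangle$ with $e^*\in E^*$, $h\in\mathcal H$, and let $\mathcal A^E$ be the set of all $f\in\mathcal A$ such that for each $e\in E$ the function $x\mapsto f(x)e$ belongs to $\mathcal H$. Let $\operatorname{Ch}_{\mathcal H}K$ be the set of all $x\in K$ for which the functional $f\mapsto f(x)$ on $\mathcal A$ is an extreme point of the closed unit ball of $\mathcal A^*$. A point $x\in K$ is a weak peak point with respect to $\mathcal H$ if for each neighbourhood $U$ of $x$ and each $\varepsilon\in(0,1)$ there is $h\in\mathcal A^E$ with $0\le h\le 1$ on $K$, $h(x)>1-\varepsilon$, and $h<\varepsilon$ on $\operatorname{Ch}_{\mathcal H}K\setminus U$; the set of all weak peak points is denoted by $\mathcal W_{\mathcal H}$. Let $\Omega_{\mathcal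 H}=\{y\in K:\ g(y)\ne0\text{ for some }g\in\mathcal H\}$. A set $\mathcal B\subseteq K$ is a boundary for $\mathcal H$ if $\|h\|=\sup_{x\in\mathcal B}\|h(x)\|$ for every $h\in\mathcal H$ (with $\sup\emptyset=0$). For a subset $S$ of a topological space, with the subspace topology, $S^{(0)}=S$, $S^{(\alpha+1)}$ is the set of accumulation points of $S^{(\alpha)}$ that belong to $S^{(\alpha)}$, and $S^{(\alpha)}=\bigcap_{\beta<\alpha}S^{(\beta)}$ for limit $\alpha$. Suppose that $E_2$ contains no isomorphic copy of $c_0$, that $\mathcal B\subseteq K_2$ is a closed boundary for $\mathcal H_2$, and that there is an into isomorphism $T:\mathcal H_1\to\mathcal H_2$ (a linear homeomorphism onto its range, on which $T^{-1}$ is defined) with $\|T\|\,\|T^{-1}\|<3$. Then for every ordinal $\alpha$: (a) if $\mathcal W_{\mathcal H_1}^{(\alpha)}$ is nonempty, then so is $\mathcal B^{(\alpha)}\cap\Omega_{\mathcal H_2}$; (b) if $\mathcal B^{(\alpha)}\cap\Omega_{\mathcal H_2}$ is finite, then so is $\mathcal W_{\mathcal H_1}^{(\alpha)}$; (c) if $\mathcal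 B^{(\alpha)}\cap\Omega_{\mathcal H_2}$ is finite, then $E_2^m$ contains an isomorphic copy of $E_1^n$, where $n=|\mathcal W_{\mathcal H_1}^{(\alpha)}|$ and $m=|\mathcal B^{(\alpha)}\cap\Omega_{\mathcal H_2}|$; in particular, if $E_1$ is finite-dimensional and isomorphic to $E_2$ (for example, $E_1=E_2$), then $n\le m$; (d) if $\mathcal H_1$ contains all constant functions and $\mathcal B^{(\alpha)}\cap\Omega_{\mathcal H_2}$ is infinite, then $|\mathcal W_{\mathcal H_1}^{(\alpha)}|\le|\mathcal B^{(\alpha)}\cap\Omega_{\mathcal H_2}|$. -/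

import Mathlib

open Set Topology Cardinal CantorBendixson

universe u v w

noncomputable section

namespace VectorFunctionSpace

/-- `X` contains an isomorphic copy of `Y`: some linear subspace of `X` is linearly homeomorphic
to `Y`. -/
def ContainsCopy (X Y : Type*) [NormedAddCommGroup X] [NormedSpace ℝ X]
    [NormedAddCommGroup Y] [NormedSpace ℝ Y] : Prop :=
  ∃ M : Submodule ℝ X, Nonempty (Y ≃L[ℝ] M)

/-- `X` contains an isomorphic copy of the Banach space `c₀` of real null sequences. -/
def ContainsC0 (X : Type*) [NormedAddCommGroup X] [NormedSpace ℝ X] : Prop :=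
  ContainsCopy X (ZeroAtInftyContinuousMap ℕ ℝ)

variable {K E : Type*} [TopologicalSpace K] [NormedAddCommGroup E] [NormedSpace ℝ E]

/-- The function `e*(h) : x ↦ ⟨e*, h x⟩`. -/
def dualComp (e' : StrongDual ℝ E) (h : C(K, E)) : C(K, ℝ) :=
  ⟨fun x => e' (h x), e'.continuous.comp h.continuous⟩

/-- The function `f ⊗ e : x ↦ f x • e`. -/
def tensor (f : C(K, ℝ)) (e : E) : C(K, E) :=
  ⟨fun x => f x • e, f.continuous.smul continuous_const⟩

/-- The set `Ω_H` of the points at which some function from `H` does not vanish. -/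
def nonvanishingSet (H : Submodule ℝ C(K, E)) : Set K :=
  {y | ∃ g ∈ H, g y ≠ 0}

variable [CompactSpace K]

/-- The canonical scalar function space `A ⊆ C(K)` of `H`: the closed linear span of the functions
`e*(h)`, where `e* ∈ E*` and `h ∈ H`. -/
def scalarSpace (H : Submodule ℝ C(K, E)) : Submodule ℝ C(K, ℝ) :=
  (Submodule.span ℝ {f | ∃ e' : StrongDual ℝ E, ∃ h ∈ H, f = dualComp e' h}).topologicalClosure

/-- The space `A^E` of those `f ∈ A` for which `f ⊗ e ∈ H` for each `e ∈ E`. -/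
def tensorSpace (H : Submodule ℝ C(K, E)) : Submodule ℝ C(K, ℝ) where
  carrier := {f | f ∈ scalarSpace H ∧ ∀ e : E, tensor f e ∈ H}
  add_mem' := by
    rintro f g ⟨hf, hf'⟩ ⟨hg, hg'⟩
    refine ⟨add_mem hf hg, fun e => ?_⟩
    have h : tensor (f + g) e = tensor f e + tensor g e := by
      ext x
      simp [tensor, add_smul]
    rw [h]
    exact add_mem (hf' e) (hg' e)
  zero_mem' := by
    refine ⟨zero_mem _, fun e => ?_⟩
    have h : tensor (0 : C(K, ℝ)) e = 0 := by
      ext x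
      simp [tensor]
    rw [h]
    exact zero_mem _
  smul_mem' := by
    rintro c f ⟨hf, hf'⟩
    refine ⟨Submodule.smul_mem _ c hf, fun e => ?_⟩
    have h : tensor (c • f) e = c • tensor f e := by
      ext x
      simp [tensor, mul_smul]
    rw [h]
    exact Submodule.smul_mem _ c (hf' e)

/-- The evaluation functional `i(x) : f ↦ f x` on a subspace `A` of `C(K)`. -/
def evalOn (A : Submodule ℝ C(K, ℝ)) (x : K) : StrongDual ℝ A :=
  (ContinuousMap.evalCLM ℝ x).comp A.subtypeL

/-- The closed unit ball of the dual space of a subspace `A` of `C(K)`: the continuous linear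
functionals on `A` of norm at most `1`. -/
def dualUnitBall (A : Submodule ℝ C(K, ℝ)) : Set (StrongDual ℝ A) :=
  {φ | ∀ f : A, |φ f| ≤ ‖f‖}

/-- The Choquet boundary of `H`: the set of those `x ∈ K` for which the evaluation at `x` is an
extreme point of the closed unit ball of the dual of the canonical scalar function space. -/
def choquetBoundary (H : Submodule ℝ C(K, E)) : Set K :=
  {x | evalOn (scalarSpace H) x ∈ extremePoints ℝ (dualUnitBall (scalarSpace H))}

/-- The set `W_H` of weak peak points of `K` with respect to `H`. -/
def weakPeakPoints (H : Submodule ℝ C(K, E)) : Set K :=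
  {x | ∀ U ∈ 𝓝 x, ∀ ε : ℝ, 0 < ε → ε < 1 →
    ∃ h ∈ tensorSpace H, (∀ y, 0 ≤ h y ∧ h y ≤ 1) ∧ 1 - ε < h x ∧
      ∀ y ∈ choquetBoundary H \ U, h y < ε}

/-- `B ⊆ K` is a boundary for `H`: `‖h‖ = sup_{x ∈ B} ‖h x‖` for each `h ∈ H`
(the supremum over the empty set is `0`; it is finite since `‖h x‖ ≤ ‖h‖`). -/
def IsBoundary (H : Submodule ℝ C(K, E)) (B : Set K) : Prop :=
  ∀ h ∈ H, ‖h‖ = ⨆ x : B, ‖h x‖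

end VectorFunctionSpace

end

/-!
Rescale `T` to an operator `τ` with `‖τ‖ < 3` and `‖g‖ ≤ sup_{y ∈ B} ‖τ g y‖`. Let `f₀ ∈ H₁` be
close to a unit vector `e` near a weak peak point `x`, and let `f` be `f₀` or `h ⊗ e` for some `h`
peaking at `x`. If `k` peaks at `x` sharply enough, then `f₀ + 2 (k ⊗ e)` has norm about `3`, while
`f₀ + 2 (k ⊗ e - f)` has norm about `1` on the Choquet boundary, and hence everywhere. So `‖τ f y‖`
is bounded away from `0` for every point `y ∈ B` at which `τ (f₀ + 2 (k ⊗ e))` has norm about `3`.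
One point `y` therefore serves any finite number of functions `f`, and, by compactness, all of them.

If the functions `hₙ` peak at the points of a sequence and are small on the Choquet boundary outside
of disjoint neighbourhoods, then the vectors `τ (hₙ ⊗ e) y` are terms of a weakly unconditionally
Cauchy series. They tend to `0`, since `E₂` does not contain `c₀` (Bessaga-Pełczyński). Hence
infinitely many points of `B` are needed to serve such a sequence: by transfinite induction, a point
of the derivative of order `α` of the set of weak peak points is served by a point of the derivative
of order `α` of `B`, and this choice of `y` is finite-to-one. For the embedding of `E₁ⁿ` into `E₂ᵐ`,
take `f₀ = ∑ hᵢ ⊗ vᵢ`.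
-/

section Convex

variable {X : Type*} [AddCommGroup X] [Module ℝ X] [TopologicalSpace X] [IsTopologicalAddGroup X]
  [ContinuousSMul ℝ X]

theorem isCompact_convexJoin {s t : Set X} (hs : IsCompact s) (ht : IsCompact t) :
    IsCompact (convexJoin ℝ s t) := by
  have himage : convexJoin ℝ s t =
      (fun p : (X × X) × ℝ => AffineMap.lineMap p.1.1 p.1.2 p.2) '' ((s ×ˢ t) ×ˢ Icc 0 1) := by
    ext z
    simp only [mem_convexJoin, segment_eq_image_lineMap, mem_image, mem_prod, Prod.exists]
    grind
  rw [himage]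
  refine ((hs.prod ht).prod isCompact_Icc).image ?_
  simp only [AffineMap.lineMap_apply_module]
  fun_prop

theorem isCompact_convexHull_biUnion {ι : Type*} (I : Finset ι) {s : ι → Set X}
    (hconv : ∀ i ∈ I, Convex ℝ (s i)) (hcomp : ∀ i ∈ I, IsCompact (s i)) :
    IsCompact (convexHull ℝ (⋃ i ∈ I, s i)) := by
  classical
  induction I using Finset.induction_on with
  | empty => simp
  | insert i I _ ih =>
    rw [Finset.forall_mem_insert] at hconv hcomp
    have hI := ih hconv.2 hcomp.2
    rw [Finset.set_biUnion_insert]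
    rcases (s i).eq_empty_or_nonempty with hi | hi
    · rwa [hi, empty_union]
    rcases (⋃ j ∈ I, s j).eq_empty_or_nonempty with hU | hU
    · rw [hU, union_empty, hconv.1.convexHull_eq]
      exact hcomp.1
    · rw [convexHull_union hi hU, hconv.1.convexHull_eq]
      exact isCompact_convexJoin hcomp.1 hI

/-- Milman's partial converse of the Krein-Milman theorem. -/
theorem extremePoints_closure_convexHull_subset [T2Space X] [LocallyConvexSpace ℝ X] {s : Set X}
    (hs : IsCompact s) (hC : IsCompact (closure (convexHull ℝ s))) :
    extremePoints ℝ (closure (convexHull ℝ s)) ⊆ s := by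
  intro x hx
  by_contra hxs
  set C := closure (convexHull ℝ s)
  have hsC : s ⊆ C := (subset_convexHull ℝ s).trans subset_closure
  have hseparate : ∀ y ∈ s, ∃ (f : StrongDual ℝ X) (a : ℝ), f x < a ∧ a < f y := fun y hy => by
    obtain ⟨f, hf⟩ := geometric_hahn_banach_point_point (ne_of_mem_of_not_mem hy hxs).symm
    exact ⟨f, exists_between hf⟩
  choose! f a hfx hfy using hseparate
  obtain ⟨I, hIs, hI⟩ := hs.elim_nhds_subcover (fun y => {z | a y < f y z})
    fun y hy => (isOpen_lt continuous_const (f y).continuous).mem_nhds (hfy y hy)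
  let piece : X → Set X := fun y => C ∩ {z | a y ≤ f y z}
  have hpiece : IsCompact (convexHull ℝ (⋃ y ∈ I, piece y)) :=
    isCompact_convexHull_biUnion I
      (fun y _ => (convex_convexHull ℝ s).closure.inter
        (convex_halfSpace_ge (f y).toLinearMap.isLinear (a y)))
      (fun y _ => hC.inter_right (isClosed_le continuous_const (f y).continuous))
  have hpieceC : convexHull ℝ (⋃ y ∈ I, piece y) ⊆ C :=
    convexHull_min (iUnion₂_subset fun y _ => inter_subset_left) (convex_convexHull ℝ s).closure
  have hCpiece : C ⊆ convexHull ℝ (⋃ y ∈ I, piece y) := by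
    refine closure_minimal (convexHull_min (fun z hz => subset_convexHull ℝ _ ?_)
      (convex_convexHull ℝ _)) hpiece.isClosed
    obtain ⟨y, hy, hyz⟩ := mem_iUnion₂.1 (hI hz)
    exact mem_iUnion₂.2 ⟨y, hy, hsC hz, (show a y < f y z from hyz).le⟩
  rw [← hpieceC.antisymm hCpiece] at hx
  obtain ⟨y, hy, -, hxy⟩ := mem_iUnion₂.1 (extremePoints_convexHull_subset hx)
  exact (hfx y (hIs y hy)).not_ge hxy

end Convex

noncomputable section

namespace VectorFunctionSpace

section WeakDualBall

variable {Y : Type*} [NormedAddCommGroup Y] [NormedSpace ℝ Y]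

/-- The closed unit ball of the dual space of `Y`, with the weak-* topology. For a subspace `A` of
`C(K)`, its elements are those of `dualUnitBall A`. -/
def weakDualBall (Y : Type*) [NormedAddCommGroup Y] [NormedSpace ℝ Y] : Set (WeakDual ℝ Y) :=
  {φ | ∀ y, |φ y| ≤ ‖y‖}

theorem weakDualBall_eq_preimage_closedBall :
    weakDualBall Y = WeakDual.toStrongDual ⁻¹' Metric.closedBall 0 1 := by
  ext φ
  rw [mem_preimage, mem_closedBall_zero_iff]
  exact ⟨fun hφ => ContinuousLinearMap.opNorm_le_bound _ zero_le_one fun y => by simpa using hφ y,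
    fun hφ y => ((WeakDual.toStrongDual φ).le_opNorm y).trans
      (mul_le_of_le_one_left (norm_nonneg y) hφ)⟩

theorem isCompact_weakDualBall : IsCompact (weakDualBall Y) := by
  rw [weakDualBall_eq_preimage_closedBall]
  exact WeakDual.isCompact_closedBall 0 1

theorem convex_weakDualBall : Convex ℝ (weakDualBall Y) := by
  rw [weakDualBall_eq_preimage_closedBall]
  exact (convex_closedBall (0 : StrongDual ℝ Y) 1).linear_preimage
    (WeakDual.toStrongDual (𝕜 := ℝ) (E := Y)).toLinearMap

theorem neg_mem_weakDualBall {φ : WeakDual ℝ Y} (hφ : φ ∈ weakDualBall Y) :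
    -φ ∈ weakDualBall Y := fun y => (abs_neg (φ y)).trans_le (hφ y)

theorem neg_mem_extremePoints_weakDualBall {φ : WeakDual ℝ Y}
    (hφ : φ ∈ extremePoints ℝ (weakDualBall Y)) : -φ ∈ extremePoints ℝ (weakDualBall Y) := by
  have hball : LinearEquiv.neg ℝ '' weakDualBall Y = weakDualBall Y :=
    Subset.antisymm (image_subset_iff.2 fun φ hφ => neg_mem_weakDualBall hφ)
      fun φ hφ => ⟨-φ, neg_mem_weakDualBall hφ, neg_neg φ⟩
  rw [← hball, ← image_extremePoints]
  exact mem_image_of_mem _ hφ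

instance : LocallyConvexSpace ℝ (WeakDual ℝ Y) :=
  inferInstanceAs (LocallyConvexSpace ℝ (WeakBilin (topDualPairing ℝ Y)))

theorem apply_le_of_forall_mem_extremePoints {y : Y} {c : ℝ}
    (h : ∀ φ ∈ extremePoints ℝ (weakDualBall Y), φ y ≤ c) {φ : WeakDual ℝ Y}
    (hφ : φ ∈ weakDualBall Y) : φ y ≤ c := by
  have hconvex : Convex ℝ {φ : WeakDual ℝ Y | φ y ≤ c} :=
    convex_halfSpace_le ⟨fun _ _ => rfl, fun _ _ => rfl⟩ c
  have hclosed : IsClosed {φ : WeakDual ℝ Y | φ y ≤ c} :=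
    isClosed_le (WeakDual.eval_continuous y) continuous_const
  rw [← closure_convexHull_extremePoints isCompact_weakDualBall convex_weakDualBall] at hφ
  exact closure_minimal (convexHull_min h hconvex) hclosed hφ

theorem closure_convexHull_eq_weakDualBall {S : Set (WeakDual ℝ Y)} (hS : S ⊆ weakDualBall Y)
    (hnorming : ∀ y c, (∀ φ ∈ S, φ y ≤ c) → ‖y‖ ≤ c) :
    closure (convexHull ℝ S) = weakDualBall Y := by
  refine (closure_minimal (convexHull_min hS convex_weakDualBall)
    isCompact_weakDualBall.isClosed).antisymm fun φ hφ => ?_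
  by_contra hφS
  obtain ⟨Λ, u, hΛu, huφ⟩ := geometric_hahn_banach_closed_point
    (convex_convexHull ℝ S).closure isClosed_closure hφS
  obtain ⟨y, rfl⟩ := LinearMap.dualEmbedding_surjective (topDualPairing ℝ Y) Λ
  have hy : ‖y‖ ≤ u := hnorming y u fun ψ hψ => (hΛu ψ (subset_closure
    (subset_convexHull ℝ S hψ))).le
  exact (huφ.trans_le ((le_abs_self _).trans (hφ y))).not_ge hy

theorem extremePoints_weakDualBall_subset {S : Set (WeakDual ℝ Y)} (hcomp : IsCompact S)
    (hS : S ⊆ weakDualBall Y) (hnorming : ∀ y c, (∀ φ ∈ S, φ y ≤ c) → ‖y‖ ≤ c) :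
    extremePoints ℝ (weakDualBall Y) ⊆ S := by
  have hclosure := closure_convexHull_eq_weakDualBall hS hnorming
  rw [← hclosure]
  exact extremePoints_closure_convexHull_subset hcomp (hclosure ▸ isCompact_weakDualBall)

end WeakDualBall

section ChoquetBoundary

variable {K E : Type*} [TopologicalSpace K] [CompactSpace K] [NormedAddCommGroup E]
  [NormedSpace ℝ E]

theorem evalOn_mem_dualUnitBall (A : Submodule ℝ C(K, ℝ)) (x : K) : evalOn A x ∈ dualUnitBall A :=
  fun f => f.1.norm_coe_le_norm x

theorem eq_evalOn_or_neg_of_mem_extremePoints {A : Submodule ℝ C(K, ℝ)} {φ : WeakDual ℝ A}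
    (hφ : φ ∈ extremePoints ℝ (weakDualBall A)) :
    φ = 0 ∨ ∃ x, StrongDual.toWeakDual (evalOn A x) = φ ∨
      -StrongDual.toWeakDual (evalOn A x) = φ := by
  let ev : K → WeakDual ℝ A := fun x => StrongDual.toWeakDual (evalOn A x)
  have hev : Continuous ev := WeakDual.continuous_of_continuous_eval fun f => f.1.continuous
  have hevBall : ∀ x, ev x ∈ weakDualBall A := evalOn_mem_dualUnitBall A
  -- `0` is added because the evaluations norm `A` only if `K` is nonempty.
  let S : Set (WeakDual ℝ A) := insert 0 (range ev ∪ range (-ev))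
  have hS : S ⊆ weakDualBall A := by
    rintro ψ (rfl | ⟨x, rfl⟩ | ⟨x, rfl⟩)
    · exact fun f => (abs_zero (α := ℝ)).trans_le (norm_nonneg f)
    · exact hevBall x
    · exact neg_mem_weakDualBall (hevBall x)
  have hnorming : ∀ f c, (∀ ψ ∈ S, ψ f ≤ c) → ‖f‖ ≤ c := fun f c h =>
    (ContinuousMap.norm_le f.1 (h 0 (mem_insert _ _))).2 fun x => abs_le'.2
      ⟨h _ (Or.inr (Or.inl ⟨x, rfl⟩)), h _ (Or.inr (Or.inr ⟨x, rfl⟩))⟩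
  obtain h | ⟨x, h⟩ | ⟨x, h⟩ := extremePoints_weakDualBall_subset
    (((isCompact_range hev).union (isCompact_range hev.neg)).insert 0) hS hnorming hφ
  exacts [Or.inl h, Or.inr ⟨x, Or.inl h⟩, Or.inr ⟨x, Or.inr h⟩]

theorem abs_le_of_forall_mem_choquetBoundary (H : Submodule ℝ C(K, E)) {f : C(K, ℝ)}
    (hf : f ∈ scalarSpace H) {c : ℝ} (hc : 0 ≤ c) (h : ∀ x ∈ choquetBoundary H, |f x| ≤ c)
    (x : K) : |f x| ≤ c := by
  have hext : ∀ φ ∈ extremePoints ℝ (weakDualBall (scalarSpace H)), φ ⟨f, hf⟩ ≤ c := by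
    intro φ hφ
    obtain rfl | ⟨y, rfl | rfl⟩ := eq_evalOn_or_neg_of_mem_extremePoints hφ
    · exact hc
    · exact (abs_le.1 (h y hφ)).2
    · have hy : y ∈ choquetBoundary H := by
        have hneg := neg_mem_extremePoints_weakDualBall hφ
        rwa [neg_neg] at hneg
      exact neg_le.1 (abs_le.1 (h y hy)).1
  have hx : evalOn (scalarSpace H) x ∈ weakDualBall (scalarSpace H) := evalOn_mem_dualUnitBall _ x
  exact abs_le'.2 ⟨apply_le_of_forall_mem_extremePoints hext hx,
    apply_le_of_forall_mem_extremePoints hext (neg_mem_weakDualBall hx)⟩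

theorem dualComp_mem_scalarSpace {H : Submodule ℝ C(K, E)} {g : C(K, E)} (hg : g ∈ H)
    (e' : StrongDual ℝ E) : dualComp e' g ∈ scalarSpace H :=
  Submodule.le_topologicalClosure _ (Submodule.subset_span ⟨e', g, hg, rfl⟩)

theorem norm_le_of_forall_mem_choquetBoundary {H : Submodule ℝ C(K, E)} {g : C(K, E)} (hg : g ∈ H)
    {c : ℝ} (hc : 0 ≤ c) (h : ∀ x ∈ choquetBoundary H, ‖g x‖ ≤ c) : ‖g‖ ≤ c := by
  rw [ContinuousMap.norm_le _ hc]
  intro x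
  obtain ⟨e', he', hx⟩ := exists_dual_vector'' ℝ (g x)
  have hcomp : |e' (g x)| ≤ c :=
    abs_le_of_forall_mem_choquetBoundary H (dualComp_mem_scalarSpace hg e') hc
      (fun y hy => ((e'.le_opNorm (g y)).trans
        (mul_le_of_le_one_left (norm_nonneg _) he')).trans (h y hy)) x
  rwa [hx, RCLike.ofReal_real_eq_id, id, abs_norm] at hcomp

end ChoquetBoundary

section ContainsC0

open Filter

variable {ι κ X Y : Type*} [NormedAddCommGroup X] [NormedSpace ℝ X]
  [NormedAddCommGroup Y] [NormedSpace ℝ Y]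

theorem containsCopy_of_le_norm (S : Y →L[ℝ] X) {c : ℝ} (hc : 0 < c)
    (hS : ∀ y, ‖y‖ = 1 → c ≤ ‖S y‖) : ContainsCopy X Y := by
  have hlow : ∀ y, c * ‖y‖ ≤ ‖S y‖ := fun y => by
    rcases eq_or_ne y 0 with rfl | hy
    · simp
    · have h := hS (‖y‖⁻¹ • y) (norm_smul_inv_norm hy)
      rwa [map_smul, norm_smul, norm_inv, norm_norm, inv_mul_eq_div,
        le_div_iff₀ (norm_pos_iff.2 hy)] at h
  have hinj : Function.Injective (S : Y →ₗ[ℝ] X) := by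
    refine (injective_iff_map_eq_zero S).2 fun y hy => norm_le_zero_iff.1 ?_
    exact nonpos_of_mul_nonpos_right ((hlow y).trans_eq (by rw [hy, norm_zero])) hc
  let e := LinearEquiv.ofInjective (S : Y →ₗ[ℝ] X) hinj
  refine ⟨_, ⟨e.toContinuousLinearEquivOfBounds ‖S‖ c⁻¹ S.le_opNorm fun z => ?_⟩⟩
  obtain ⟨y, rfl⟩ := e.surjective z
  rw [e.symm_apply_apply, ← div_eq_inv_mul, le_div_iff₀' hc]
  exact hlow y

/-- The series `∑ v i` is weakly unconditionally Cauchy, with the explicit bound `C` for the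
absolute sums of its images under norm-one functionals. -/
def IsWeaklyUnconditionallyCauchy (v : ι → X) (C : ℝ) : Prop :=
  ∀ φ : StrongDual ℝ X, ‖φ‖ ≤ 1 → ∀ s : Finset ι, ∑ i ∈ s, |φ (v i)| ≤ C

namespace IsWeaklyUnconditionallyCauchy

variable {v : ι → X} {C : ℝ}

theorem of_norm_sum_smul_le
    (h : ∀ (s : Finset ι) (a : ι → ℝ), (∀ i, |a i| ≤ 1) → ‖∑ i ∈ s, a i • v i‖ ≤ C) :
    IsWeaklyUnconditionallyCauchy v C := by
  intro φ hφ s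
  let a : ι → ℝ := fun i => SignType.sign (φ (v i))
  have ha : ∀ i, |a i| ≤ 1 := fun i => by
    rcases lt_trichotomy (φ (v i)) 0 with hi | hi | hi <;> simp [a, hi]
  calc ∑ i ∈ s, |φ (v i)| = φ (∑ i ∈ s, a i • v i) := by simp [a, sign_mul_self]
    _ ≤ ‖φ‖ * ‖∑ i ∈ s, a i • v i‖ := (le_abs_self _).trans (φ.le_opNorm _)
    _ ≤ ‖∑ i ∈ s, a i • v i‖ := mul_le_of_le_one_left (norm_nonneg _) hφ
    _ ≤ C := h s a ha

theorem comp (hv : IsWeaklyUnconditionallyCauchy v C) (f : κ ↪ ι) :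
    IsWeaklyUnconditionallyCauchy (v ∘ f) C := fun φ hφ s => by
  simpa using hv φ hφ (s.map f)

theorem nonneg (hv : IsWeaklyUnconditionallyCauchy v C) : 0 ≤ C := by
  simpa using hv 0 (by simp) ∅

theorem norm_sum_smul_le (hv : IsWeaklyUnconditionallyCauchy v C) {s : Finset ι} {a : ι → ℝ} {r : ℝ}
    (hr : 0 ≤ r) (ha : ∀ i ∈ s, |a i| ≤ r) : ‖∑ i ∈ s, a i • v i‖ ≤ C * r := by
  obtain ⟨φ, hφ, hsum⟩ := exists_dual_vector'' ℝ (∑ i ∈ s, a i • v i)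
  rw [RCLike.ofReal_real_eq_id, id] at hsum
  calc ‖∑ i ∈ s, a i • v i‖ = ∑ i ∈ s, a i * φ (v i) := by rw [← hsum]; simp
    _ ≤ ∑ i ∈ s, |φ (v i)| * r := Finset.sum_le_sum fun i hi => by
        rw [mul_comm]
        exact (le_abs_self _).trans ((abs_mul _ _).trans_le (by gcongr; exact ha i hi))
    _ ≤ C * r := by
        rw [← Finset.sum_mul]
        exact mul_le_mul_of_nonneg_right (hv φ hφ s) hr

theorem summable_smul [CompleteSpace X] (hv : IsWeaklyUnconditionallyCauchy v C) {a : ι → ℝ}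
    (ha : Tendsto a cofinite (𝓝 0)) : Summable fun i => a i • v i := by
  have hC := hv.nonneg
  refine summable_iff_vanishing_norm.2 fun ε hε => ?_
  have hsmall : {i | ¬ ‖a i‖ < ε / (C + 1)}.Finite :=
    eventually_cofinite.1 (ha.norm.eventually_lt_const (by rw [norm_zero]; positivity))
  refine ⟨hsmall.toFinset, fun t ht => ?_⟩
  have hat : ∀ i ∈ t, |a i| ≤ ε / (C + 1) := fun i hi => by
    have := Finset.disjoint_left.1 ht hi
    simp only [Finite.mem_toFinset, mem_ofPred_eq, not_not] at this
    exact this.le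
  refine (hv.norm_sum_smul_le (by positivity) hat).trans_lt ?_
  rw [mul_div_assoc', div_lt_iff₀ (by positivity)]
  nlinarith

theorem containsC0_of_le_norm_sum [CompleteSpace X] {v : ℕ → X}
    (hv : IsWeaklyUnconditionallyCauchy v C) {η : ℝ} (hη : 0 < η)
    (hlow : ∀ (s : Finset ℕ) (a : ℕ → ℝ), ∀ n ∈ s, η * |a n| ≤ ‖∑ n ∈ s, a n • v n‖) :
    ContainsC0 X := by
  have hsum : ∀ f : ZeroAtInftyContinuousMap ℕ ℝ, HasSum (fun n => f n • v n) (∑' n, f n • v n) :=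
    fun f => (hv.summable_smul (cocompact_eq_cofinite ℕ ▸ f.zero_at_infty')).hasSum
  let S : ZeroAtInftyContinuousMap ℕ ℝ →ₗ[ℝ] X :=
    { toFun := fun f => ∑' n, f n • v n
      map_add' := fun f g => by simpa [add_smul] using ((hsum f).add (hsum g)).tsum_eq
      map_smul' := fun c f => by simpa [mul_smul] using ((hsum f).const_smul c).tsum_eq }
  have hf : ∀ (f : ZeroAtInftyContinuousMap ℕ ℝ) n, |f n| ≤ ‖f‖ := fun f =>
    f.norm_toBCF_eq_norm ▸ f.toBCF.norm_coe_le_norm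
  have hSup : ∀ f, ‖S f‖ ≤ C * ‖f‖ := fun f =>
    le_of_tendsto (hsum f).norm (.of_forall fun s =>
      hv.norm_sum_smul_le (norm_nonneg f) fun n _ => hf f n)
  have hSlow : ∀ f n, η * |f n| ≤ ‖S f‖ := fun f n =>
    ge_of_tendsto (hsum f).norm ((eventually_ge_atTop {n}).mono fun s hs =>
      hlow s f n (hs (Finset.mem_singleton_self n)))
  refine containsCopy_of_le_norm (S.mkContinuous C hSup) hη fun f hf1 => ?_
  have hnorm : ‖f‖ ≤ ‖S f‖ / η := by
    rw [← ZeroAtInftyContinuousMap.norm_toBCF_eq_norm,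
      BoundedContinuousFunction.norm_le (by positivity)]
    exact fun n => (le_div_iff₀' hη).2 (hSlow f n)
  rwa [hf1, one_le_div₀ hη] at hnorm

end IsWeaklyUnconditionallyCauchy

/-- A finitary form of Rosenthal's disjointness lemma. -/
theorem exists_embedding_sum_le {η : ℝ} (hη : 0 ≤ η) (N : ℕ) : ∀ b : ℕ → ℕ → ℝ,
    (∀ i (s : Finset ℕ), i ∉ s → ∑ j ∈ s, b i j ≤ N * η) →
    ∃ σ : ℕ ↪ ℕ, ∀ i (s : Finset ℕ), i ∉ s → ∑ j ∈ s, b (σ i) (σ j) ≤ η := by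
  induction N with
  | zero =>
    exact fun b hb => ⟨.refl ℕ, fun i s hi => (hb i s hi).trans (by simpa using hη)⟩
  | succ N ih =>
    intro b hb
    let row : ℕ → ℕ ↪ ℕ := fun p => ⟨Nat.pair p, fun i j h => (Nat.pair_eq_pair.1 h).2⟩
    by_cases hrow : ∃ p, ∀ i (s : Finset ℕ), i ∉ s → ∑ j ∈ s, b (row p i) (row p j) ≤ η
    · exact ⟨row hrow.choose, hrow.choose_spec⟩
    push Not at hrow
    choose i s hi hlt using hrow
    -- Each transversal entry `row p (i p)` already loses more than `η` within its own row.
    let τ : ℕ ↪ ℕ := ⟨fun p => row p (i p), fun p q h => (Nat.pair_eq_pair.1 h).1⟩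
    have hτ : ∀ p (t : Finset ℕ), p ∉ t → ∑ q ∈ t, b (τ p) (τ q) ≤ N * η := by
      intro p t hp
      have hne : ∀ q ∈ t, ∀ k, row p k ≠ τ q := fun q hq k h =>
        hp ((Nat.pair_eq_pair.1 h).1 ▸ hq)
      have hdisj : Disjoint (t.map τ) ((s p).map (row p)) := by
        simp only [Finset.disjoint_left, Finset.mem_map]
        rintro _ ⟨q, hq, rfl⟩ ⟨k, -, hk⟩
        exact hne q hq k hk
      have hnotMem : τ p ∉ t.map τ ∪ (s p).map (row p) := by
        rw [Finset.mem_union, Finset.mem_map' τ]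
        exact not_or.2 ⟨hp, fun h => hi p ((Finset.mem_map' (row p)).1 h)⟩
      have htotal := hb (τ p) _ hnotMem
      rw [Finset.sum_union hdisj, Finset.sum_map, Finset.sum_map] at htotal
      have hrowp : η < ∑ k ∈ s p, b (τ p) (row p k) := hlt p
      push_cast at htotal
      linarith
    obtain ⟨σ, hσ⟩ := ih (fun p q => b (τ p) (τ q)) hτ
    exact ⟨σ.trans τ, hσ⟩

theorem mul_abs_le_norm_sum_smul {v : ι → X} {φ : ι → StrongDual ℝ X} {δ η : ℝ}
    (hφ : ∀ i, ‖φ i‖ ≤ 1) (hdiag : ∀ i, δ ≤ φ i (v i))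
    (hoff : ∀ i (s : Finset ι), i ∉ s → ∑ j ∈ s, |φ i (v j)| ≤ η) (hδη : 0 ≤ δ - η)
    (s : Finset ι) (a : ι → ℝ) {n : ι} (hn : n ∈ s) :
    (δ - η) * |a n| ≤ ‖∑ i ∈ s, a i • v i‖ := by
  classical
  obtain ⟨m, hm, hmax⟩ := s.exists_max_image (fun i => |a i|) ⟨n, hn⟩
  have hsplit : φ m (∑ i ∈ s, a i • v i) =
      a m * φ m (v m) + ∑ i ∈ s.erase m, a i * φ m (v i) := by
    simp [map_sum, Finset.add_sum_erase s (fun i => a i * φ m (v i)) hm]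
  have hrest : |∑ i ∈ s.erase m, a i * φ m (v i)| ≤ |a m| * η := calc
    _ ≤ ∑ i ∈ s.erase m, |a m| * |φ m (v i)| := by
      refine (Finset.abs_sum_le_sum_abs _ _).trans (Finset.sum_le_sum fun i hi => ?_)
      rw [abs_mul]
      exact mul_le_mul_of_nonneg_right (hmax i (Finset.mem_of_mem_erase hi)) (abs_nonneg _)
    _ ≤ |a m| * η := by
      rw [← Finset.mul_sum]
      exact mul_le_mul_of_nonneg_left (hoff m _ (Finset.notMem_erase m s)) (abs_nonneg _)
  have hmain : |a m| * δ ≤ |a m * φ m (v m)| := by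
    rw [abs_mul]
    exact mul_le_mul_of_nonneg_left ((hdiag m).trans (le_abs_self _)) (abs_nonneg _)
  calc (δ - η) * |a n| ≤ (δ - η) * |a m| := mul_le_mul_of_nonneg_left (hmax n hn) hδη
    _ ≤ |a m * φ m (v m)| - |∑ i ∈ s.erase m, a i * φ m (v i)| := by linarith
    _ ≤ |φ m (∑ i ∈ s, a i • v i)| := hsplit ▸ abs_sub_abs_le_abs_add _ _
    _ ≤ ‖∑ i ∈ s, a i • v i‖ :=
      ((φ m).le_opNorm _).trans (mul_le_of_le_one_left (norm_nonneg _) (hφ m))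

namespace IsWeaklyUnconditionallyCauchy

theorem containsC0_of_le_norm [CompleteSpace X] {v : ℕ → X} {C δ : ℝ}
    (hv : IsWeaklyUnconditionallyCauchy v C) (hδ : 0 < δ) (hδv : ∀ n, δ ≤ ‖v n‖) :
    ContainsC0 X := by
  choose φ hφ hφv using fun n => exists_dual_vector'' ℝ (v n)
  obtain ⟨N, hN⟩ := exists_nat_ge (C / (δ / 2))
  obtain ⟨σ, hσ⟩ := exists_embedding_sum_le (half_pos hδ).le N (fun n k => |φ n (v k)|)
    fun n s _ => (hv (φ n) (hφ n) s).trans ((div_le_iff₀ (half_pos hδ)).1 hN)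
  refine (hv.comp σ).containsC0_of_le_norm_sum (half_pos hδ) fun s a n hn => ?_
  have hdiag : ∀ n, δ ≤ φ (σ n) (v (σ n)) := fun n => by
    rw [hφv]
    exact hδv (σ n)
  have h := mul_abs_le_norm_sum_smul (v := v ∘ σ) (fun n => hφ (σ n)) hdiag hσ
    (by linarith) s a hn
  rwa [sub_half] at h

/-- The Bessaga-Pełczyński theorem. -/
theorem tendsto_zero [CompleteSpace X] {v : ℕ → X} {C : ℝ} (hX : ¬ ContainsC0 X)
    (hv : IsWeaklyUnconditionallyCauchy v C) : Tendsto v atTop (𝓝 0) := by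
  refine NormedAddGroup.tendsto_nhds_zero.2 fun δ hδ => ?_
  by_contra hfreq
  have hinf : {n | δ ≤ ‖v n‖}.Infinite := by
    simpa [Nat.frequently_atTop_iff_infinite] using not_eventually.1 hfreq
  exact hX ((hv.comp ((hinf.natEmbedding _).trans (.subtype _))).containsC0_of_le_norm hδ
    fun n => (hinf.natEmbedding _ n).2)

end IsWeaklyUnconditionallyCauchy

end ContainsC0

section Topology

open Filter

variable {X : Type*} [TopologicalSpace X]

theorem exists_mem_disjoint_nhds_of_accPt [T2Space X] {p : X} {S O : Set X} (hp : AccPt p (𝓟 S))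
    (hO : O ∈ 𝓝 p) : ∃ x ∈ S, ∃ V O' : Set X,
      IsOpen V ∧ x ∈ V ∧ V ⊆ O ∧ O' ∈ 𝓝 p ∧ O' ⊆ O ∧ Disjoint V O' := by
  obtain ⟨x, ⟨hxO, hxS⟩, hxp⟩ := accPt_iff_nhds.1 hp (interior O) (interior_mem_nhds.2 hO)
  obtain ⟨V, W, hV, hW, hxV, hpW, hVW⟩ := t2_separation hxp
  exact ⟨x, hxS, V ∩ interior O, W ∩ O, hV.inter isOpen_interior, ⟨hxV, hxO⟩,
    inter_subset_right.trans interior_subset, inter_mem (hW.mem_nhds hpW) hO,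
    inter_subset_right, hVW.mono inter_subset_left inter_subset_left⟩

theorem exists_seq_disjoint_nhds [T2Space X] {p : X} {S : Set X} (hp : AccPt p (𝓟 S)) :
    ∃ (x : ℕ → X) (V : ℕ → Set X),
      (∀ n, x n ∈ S ∧ V n ∈ 𝓝 (x n)) ∧ Pairwise (Function.onFun Disjoint V) := by
  choose x hxS V next hV hxV hVO hnext_nhds hnext hdisj using
    fun O : {O : Set X // O ∈ 𝓝 p} => exists_mem_disjoint_nhds_of_accPt hp O.2
  let O : ℕ → {O : Set X // O ∈ 𝓝 p} :=
    fun n => (fun O => ⟨next O, hnext_nhds O⟩)^[n] ⟨univ, univ_mem⟩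
  have hO : ∀ n, (O (n + 1)).1 = next (O n) := fun n =>
    congrArg Subtype.val (Function.iterate_succ_apply' _ _ _)
  have hanti : Antitone fun n => (O n).1 := antitone_nat_of_succ_le fun n => by
    rw [hO]
    exact hnext _
  refine ⟨fun n => x (O n), fun n => V (O n),
    fun n => ⟨hxS _, (hV _).mem_nhds (hxV _)⟩, (pairwise_disjoint_on _).2 fun m n hmn => ?_⟩
  refine (hdisj (O m)).mono_right ((hVO (O n)).trans ?_)
  rw [← hO]
  exact hanti hmn

theorem iteratedDerivedSet_subset (S : Set X) (α : Ordinal) : iteratedDerivedSet S α ⊆ S := by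
  simpa only [iteratedDerivedSet_zero] using iteratedDerivedSet_antitone S (zero_le (a := α))

end Topology

theorem sum_le_one_add_of_disjoint {ι X : Type*} {V : ι → Set X}
    (hV : Pairwise (Function.onFun Disjoint V)) {f : ι → X → ℝ} {ε : ι → ℝ} {x : X}
    (hε : ∀ i, 0 ≤ ε i) (hf1 : ∀ i, f i x ≤ 1) (hf : ∀ i, x ∉ V i → f i x ≤ ε i) (s : Finset ι) :
    ∑ i ∈ s, f i x ≤ 1 + ∑ i ∈ s, ε i := by
  classical
  by_cases h : ∃ j ∈ s, x ∈ V j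
  · obtain ⟨j, hj, hxj⟩ := h
    have hne : ∀ i ∈ s.erase j, x ∉ V i := fun i hi hxi =>
      disjoint_left.1 (hV (Finset.ne_of_mem_erase hi)) hxi hxj
    calc ∑ i ∈ s, f i x = f j x + ∑ i ∈ s.erase j, f i x := (Finset.add_sum_erase s _ hj).symm
      _ ≤ 1 + ∑ i ∈ s.erase j, ε i :=
        add_le_add (hf1 j) (Finset.sum_le_sum fun i hi => hf i (hne i hi))
      _ ≤ 1 + ∑ i ∈ s, ε i := by
        gcongr
        · exact fun i _ _ => hε i
        · exact Finset.erase_subset _ _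
  · push Not at h
    linarith [Finset.sum_le_sum fun i hi => hf i (h i hi)]

section Peaks

variable {K E : Type*} [TopologicalSpace K] [CompactSpace K] [NormedAddCommGroup E]
  [NormedSpace ℝ E] {H : Submodule ℝ C(K, E)}

/-- The operator `e ↦ h ⊗ e` from `E` to `H`. -/
def tensorCLM (h : tensorSpace H) : E →L[ℝ] H :=
  LinearMap.mkContinuous
    { toFun := fun e => ⟨tensor h e, h.2.2 e⟩
      map_add' := fun e e' => Subtype.ext (ContinuousMap.ext fun _ => smul_add _ e e')
      map_smul' := fun c e => Subtype.ext (ContinuousMap.ext fun _ => smul_comm _ c e) }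
    ‖(h : C(K, ℝ))‖ fun e => by
      refine (ContinuousMap.norm_le _ (by positivity)).2 fun t => (norm_smul_le _ _).trans ?_
      gcongr
      exact (h : C(K, ℝ)).norm_coe_le_norm t

theorem tensorCLM_apply (h : tensorSpace H) (e : E) (t : K) :
    (tensorCLM h e : C(K, E)) t = (h : C(K, ℝ)) t • e := rfl

/-- The function `h` witnesses up to `ε` that `x` is a weak peak point: it takes values in
`[0, 1]`, it is close to `1` at `x`, and it is small on the Choquet boundary outside of `U`. -/
structure PeaksAt (H : Submodule ℝ C(K, E)) (h : C(K, ℝ)) (x : K) (U : Set K) (ε : ℝ) : Prop where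
  nonneg : ∀ t, 0 ≤ h t
  le_one : ∀ t, h t ≤ 1
  lt_apply : 1 - ε < h x
  lt_of_notMem : ∀ t ∈ choquetBoundary H, t ∉ U → h t < ε

theorem exists_peaksAt {x : K} (hx : x ∈ weakPeakPoints H) {U : Set K} (hU : U ∈ 𝓝 x) {ε : ℝ}
    (hε : 0 < ε) (hε1 : ε < 1) : ∃ h : tensorSpace H, PeaksAt H h x U ε := by
  obtain ⟨h, hh, h1, h2, h3⟩ := hx U hU ε hε hε1
  exact ⟨⟨h, hh⟩, fun t => (h1 t).1, fun t => (h1 t).2, h2, fun t ht htU => h3 t ⟨ht, htU⟩⟩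

theorem weakPeakPoints_subset_closure (H : Submodule ℝ C(K, E)) :
    weakPeakPoints H ⊆ closure (choquetBoundary H) := by
  refine fun x hx => mem_closure_iff_nhds.2 fun U hU => ?_
  by_contra hne
  obtain ⟨h, hh⟩ := exists_peaksAt hx hU (ε := 1 / 2) (by norm_num) (by norm_num)
  have hle : |(h : C(K, ℝ)) x| ≤ 1 / 2 := by
    refine abs_le_of_forall_mem_choquetBoundary H h.2.1 (by norm_num) (fun t ht => ?_) x
    rw [abs_of_nonneg (hh.nonneg t)]
    exact (hh.lt_of_notMem t ht fun htU => hne ⟨t, htU, ht⟩).le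
  linarith [hh.lt_apply, le_abs_self ((h : C(K, ℝ)) x)]

namespace PeaksAt

variable {h : C(K, ℝ)} {x : K} {U U' : Set K} {ε ε' : ℝ}

theorem mono (hh : PeaksAt H h x U ε) (hU : U ⊆ U') (hε : ε ≤ ε') : PeaksAt H h x U' ε' :=
  ⟨hh.nonneg, hh.le_one, by linarith [hh.lt_apply],
    fun t ht htU => (hh.lt_of_notMem t ht fun h => htU (hU h)).trans_le hε⟩

theorem pos (hh : PeaksAt H h x U ε) : 0 < ε := by
  linarith [hh.lt_apply, hh.le_one x]

theorem apply_le_of_disjoint (hh : PeaksAt H h x U ε) {z : K} (hz : z ∈ weakPeakPoints H)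
    {W : Set K} (hW : IsOpen W) (hzW : z ∈ W) (hUW : Disjoint U W) : h z ≤ ε := by
  have hmem : z ∈ closure (W ∩ choquetBoundary H) :=
    hW.inter_closure ⟨hzW, weakPeakPoints_subset_closure H hz⟩
  exact closure_minimal (fun t ht => (hh.lt_of_notMem t ht.2 fun htU =>
    disjoint_left.1 hUW htU ht.1).le) (isClosed_le h.continuous continuous_const) hmem

end PeaksAt

theorem sum_tensorCLM_apply {ι : Type*} (h : ι → tensorSpace H) (v : ι → E) (s : Finset ι)
    (t : K) : (↑(∑ i ∈ s, tensorCLM (h i) (v i)) : C(K, E)) t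
      = ∑ i ∈ s, (h i : C(K, ℝ)) t • v i := by
  simp [ContinuousMap.sum_apply, tensorCLM_apply]

theorem norm_sum_tensorCLM_apply_le {ι : Type*} {h : ι → tensorSpace H} {x : ι → K}
    {V : ι → Set K} {ε : ι → ℝ} (hV : Pairwise (Function.onFun Disjoint V))
    (hh : ∀ i, PeaksAt H (h i) (x i) (V i) (ε i)) {v : ι → E} {r : ℝ} (hr : 0 ≤ r)
    (hv : ∀ i, ‖v i‖ ≤ r) (s : Finset ι) {t : K} (ht : t ∈ choquetBoundary H) :
    ‖(↑(∑ i ∈ s, tensorCLM (h i) (v i)) : C(K, E)) t‖ ≤ (1 + ∑ i ∈ s, ε i) * r := by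
  calc ‖(↑(∑ i ∈ s, tensorCLM (h i) (v i)) : C(K, E)) t‖
      = ‖∑ i ∈ s, (h i : C(K, ℝ)) t • v i‖ := by rw [sum_tensorCLM_apply]
    _ ≤ ∑ i ∈ s, (h i : C(K, ℝ)) t * r := by
      refine norm_sum_le_of_le s fun i _ => ?_
      rw [norm_smul, Real.norm_of_nonneg ((hh i).nonneg t)]
      exact mul_le_mul_of_nonneg_left (hv i) ((hh i).nonneg t)
    _ ≤ (1 + ∑ i ∈ s, ε i) * r := by
      rw [← Finset.sum_mul]
      refine mul_le_mul_of_nonneg_right ?_ hr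
      exact sum_le_one_add_of_disjoint hV (f := fun i => (h i : C(K, ℝ)))
        (fun i => (hh i).pos.le) (fun i => (hh i).le_one t)
        (fun i hi => ((hh i).lt_of_notMem t ht hi).le) s

end Peaks

open Filter

section LargeSet

variable {K₁ K₂ E₁ E₂ : Type*} [TopologicalSpace K₁] [TopologicalSpace K₂]
  [NormedAddCommGroup E₁] [NormedSpace ℝ E₁] [NormedAddCommGroup E₂] [NormedSpace ℝ E₂]
  {H : Submodule ℝ C(K₁, E₁)} {τ : H →L[ℝ] C(K₂, E₂)}

/-- The set of the points at which all functions from `τ '' S` have norm at least `δ`. -/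
def largeSet (τ : H →L[ℝ] C(K₂, E₂)) (δ : ℝ) (S : Set H) : Set K₂ :=
  {y | ∀ f ∈ S, δ ≤ ‖τ f y‖}

theorem isClosed_largeSet (τ : H →L[ℝ] C(K₂, E₂)) (δ : ℝ) (S : Set H) :
    IsClosed (largeSet τ δ S) := by
  simp only [largeSet, ofPred_forall]
  exact isClosed_biInter fun f _ => isClosed_le continuous_const (τ f).continuous.norm

theorem inter_largeSet_nonempty_of_forall_finite {C : Set K₂} (hC : IsCompact C) {δ : ℝ}
    {S : Set H} (h : ∀ F ⊆ S, F.Finite → (C ∩ largeSet τ δ F).Nonempty) :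
    (C ∩ largeSet τ δ S).Nonempty := by
  obtain ⟨y, hy, hyS⟩ := hC.inter_iInter_nonempty (fun f : S => largeSet τ δ {f.1})
    (fun f => isClosed_largeSet τ δ _) fun u => by
      obtain ⟨y, hy, hyF⟩ := h (Subtype.val '' (u : Set S)) (Subtype.coe_image_subset _ _)
        (u.finite_toSet.image _)
      refine ⟨y, hy, mem_iInter₂.2 fun f hf => ?_⟩
      rintro _ rfl
      exact hyF _ (mem_image_of_mem _ hf)
  exact ⟨y, hy, fun f hf => mem_iInter.1 hyS ⟨f, hf⟩ f rfl⟩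

end LargeSet

section Operator

variable {K₁ K₂ E₁ E₂ : Type*} [TopologicalSpace K₁] [CompactSpace K₁]
  [TopologicalSpace K₂] [CompactSpace K₂]
  [NormedAddCommGroup E₁] [NormedSpace ℝ E₁] [NormedAddCommGroup E₂] [NormedSpace ℝ E₂]
  {H : Submodule ℝ C(K₁, E₁)} {τ : H →L[ℝ] C(K₂, E₂)} {B : Set K₂}

/-- The operator `τ` does not decrease norms, even if its values are only measured on `B`: this is
`‖g‖ ≤ sup_{y ∈ B} ‖τ g y‖`, stated without the supremum. -/
def BoundedBelowOn (τ : H →L[ℝ] C(K₂, E₂)) (B : Set K₂) : Prop :=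
  ∀ g c, 0 ≤ c → (∀ y ∈ B, ‖τ g y‖ ≤ c) → ‖g‖ ≤ c

theorem exists_boundedBelowOn {H₂ M : Submodule ℝ C(K₂, E₂)} (hB : IsBoundary H₂ B) (hM : M ≤ H₂)
    (T : H ≃L[ℝ] M) (hT : ‖(T : H →L[ℝ] M)‖ * ‖(T.symm : M →L[ℝ] H)‖ < 3) :
    ∃ τ : H →L[ℝ] C(K₂, E₂), ‖τ‖ < 3 ∧ BoundedBelowOn τ B ∧ ∀ g, τ g ∈ H₂ := by
  set s : ℝ := ‖(T.symm : M →L[ℝ] H)‖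
  have hs : 0 ≤ s := ContinuousLinearMap.opNorm_nonneg _
  have hmem : ∀ g, s • (T g : C(K₂, E₂)) ∈ H₂ := fun g => H₂.smul_mem s (hM (T g).2)
  refine ⟨s • M.subtypeL ∘L (T : H →L[ℝ] M), ?_, fun g c hc hg => ?_, hmem⟩
  · refine lt_of_le_of_lt (ContinuousLinearMap.opNorm_le_bound _ (by positivity) fun g => ?_) hT
    calc ‖s • (T g : C(K₂, E₂))‖ = s * ‖T g‖ := norm_smul_of_nonneg hs _
      _ ≤ s * (‖(T : H →L[ℝ] M)‖ * ‖g‖) := by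
        gcongr
        exact (T : H →L[ℝ] M).le_opNorm g
      _ = ‖(T : H →L[ℝ] M)‖ * s * ‖g‖ := by ring
  · calc ‖g‖ = ‖(T.symm : M →L[ℝ] H) (T g)‖ := by simp
      _ ≤ s * ‖T g‖ := (T.symm : M →L[ℝ] H).le_opNorm _
      _ = ‖s • (T g : C(K₂, E₂))‖ := (norm_smul_of_nonneg hs _).symm
      _ = ⨆ y : B, ‖(s • (T g : C(K₂, E₂))) y‖ := hB _ (hmem g)
      _ ≤ c := Real.iSup_le (fun y => hg y y.2) hc

theorem norm_map_apply_le (τ : H →L[ℝ] C(K₂, E₂)) {g : H} {c : ℝ} (hc : 0 ≤ c)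
    (hg : ∀ t ∈ choquetBoundary H, ‖(g : C(K₁, E₁)) t‖ ≤ c) (y : K₂) : ‖τ g y‖ ≤ ‖τ‖ * c :=
  ((τ g).norm_coe_le_norm y).trans
    (τ.le_opNorm_of_le (norm_le_of_forall_mem_choquetBoundary g.2 hc hg))

theorem tendsto_map_tensorCLM_apply [CompleteSpace E₂] (hE₂ : ¬ ContainsC0 E₂)
    (τ : H →L[ℝ] C(K₂, E₂)) {h : ℕ → tensorSpace H} {x : ℕ → K₁} {V : ℕ → Set K₁}
    (hV : Pairwise (Function.onFun Disjoint V))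
    (hh : ∀ n, PeaksAt H (h n) (x n) (V n) ((1 / 2) ^ n)) (e : E₁) (y : K₂) :
    Tendsto (fun n => τ (tensorCLM (h n) e) y) atTop (𝓝 0) := by
  refine IsWeaklyUnconditionallyCauchy.tendsto_zero hE₂ (C := ‖τ‖ * (3 * ‖e‖))
    (.of_norm_sum_smul_le fun s a ha => ?_)
  have hsum : ∑ n ∈ s, a n • τ (tensorCLM (h n) e) y
      = τ (∑ n ∈ s, tensorCLM (h n) (a n • e)) y := by
    simp [ContinuousMap.sum_apply]
  rw [hsum]
  refine norm_map_apply_le τ (by positivity) (fun t ht => ?_) y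
  refine (norm_sum_tensorCLM_apply_le hV hh (norm_nonneg e) (fun n => ?_) s ht).trans ?_
  · rw [norm_smul]
    exact mul_le_of_le_one_left (norm_nonneg e) (ha n)
  · gcongr
    have := summable_geometric_two.sum_le_tsum s fun n _ => by positivity
    rw [tsum_geometric_two] at this
    linarith

theorem exists_seq_peaksAt_tendsto_zero [T2Space K₁] [CompleteSpace E₂] (hE₂ : ¬ ContainsC0 E₂)
    (τ : H →L[ℝ] C(K₂, E₂)) {p : K₁} {S : Set K₁} (hp : AccPt p (𝓟 S)) (hS : S ⊆ weakPeakPoints H)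
    {U : K₁ → Set K₁} (hU : ∀ z ∈ S, U z ∈ 𝓝 z) {ε : ℝ} (hε : 0 < ε) (hε1 : ε < 1) :
    ∃ (z : ℕ → K₁) (h : ℕ → tensorSpace H),
      (∀ n, z n ∈ S ∧ PeaksAt H (h n) (z n) (U (z n)) ε) ∧
      ∀ e y, Tendsto (fun n => τ (tensorCLM (h n) e) y) atTop (𝓝 0) := by
  obtain ⟨z, V, hz, hV⟩ := exists_seq_disjoint_nhds hp
  have hpow : ∀ n, ε * (1 / 2) ^ n ≤ ε := fun n =>
    mul_le_of_le_one_right hε.le (pow_le_one₀ (by norm_num) (by norm_num))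
  have hpeak : ∀ n, ∃ h : tensorSpace H, PeaksAt H h (z n) (V n ∩ U (z n)) (ε * (1 / 2) ^ n) :=
    fun n => exists_peaksAt (hS (hz n).1) (inter_mem (hz n).2 (hU _ (hz n).1)) (by positivity)
      ((hpow n).trans_lt hε1)
  choose h hh using hpeak
  refine ⟨z, h, fun n => ⟨(hz n).1, (hh n).mono inter_subset_right (hpow n)⟩, fun e y => ?_⟩
  exact tendsto_map_tensorCLM_apply hE₂ τ hV (fun n => (hh n).mono inter_subset_left
    (mul_le_of_le_one_left (by positivity) hε1.le)) e y

/-- The function `f` is a vector version of a peak function: up to `ε`, it is bounded by `1` on the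
Choquet boundary, and it is equal to the unit vector `e` on the open set `U`. -/
structure IsPlateau (f : H) (e : E₁) (U : Set K₁) (ε : ℝ) : Prop where
  isOpen : IsOpen U
  norm_eq : ‖e‖ = 1
  norm_apply_le : ∀ t ∈ choquetBoundary H, ‖(f : C(K₁, E₁)) t‖ ≤ 1 + ε
  norm_apply_sub_le : ∀ t ∈ U, ‖(f : C(K₁, E₁)) t - e‖ ≤ ε

/-- The functions whose images under `τ` are to be simultaneously large: `f₀` together with
`h ⊗ e` for all the functions `h` that peak at `x`. -/
def testFamily (f₀ : H) (e : E₁) (x : K₁) (U : Set K₁) (ε : ℝ) : Set H :=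
  insert f₀ ((fun h => tensorCLM h e) '' {h | PeaksAt H h x U ε})

theorem eventually_mem_testFamily {f₀ f : H} {e : E₁} {x : K₁} {U : Set K₁} {ε : ℝ}
    (hf : f ∈ testFamily f₀ e x U ε) : ∀ᶠ z in 𝓝 x, f ∈ testFamily f₀ e z U ε := by
  obtain rfl | ⟨h, hh, rfl⟩ := hf
  · exact .of_forall fun z => mem_insert _ _
  · filter_upwards [((h : C(K₁, ℝ)).continuous.tendsto x).eventually_const_lt hh.lt_apply] with z hz
    exact mem_insert_of_mem _ ⟨h, ⟨hh.nonneg, hh.le_one, hz, hh.lt_of_notMem⟩, rfl⟩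

namespace IsPlateau

variable {f₀ : H} {e : E₁} {U O : Set K₁} {ε : ℝ} {k h : tensorSpace H} {x z : K₁}

theorem norm_smul_eq (hf₀ : IsPlateau f₀ e U ε) (c : ℝ) : ‖c • e‖ = |c| := by
  rw [norm_smul, hf₀.norm_eq, mul_one, Real.norm_eq_abs]

theorem norm_add_tensorCLM_sub_self_apply_le (hf₀ : IsPlateau f₀ e U ε)
    (hk : PeaksAt H k z O ε) (hO : O ⊆ U) {t : K₁} (ht : t ∈ choquetBoundary H) :
    ‖(↑(f₀ + (2 : ℝ) • (tensorCLM k e - f₀)) : C(K₁, E₁)) t‖ ≤ 1 + 3 * ε := by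
  change ‖(f₀ : C(K₁, E₁)) t + (2 : ℝ) • ((k : C(K₁, ℝ)) t • e - (f₀ : C(K₁, E₁)) t)‖ ≤ _
  have hk0 := hk.nonneg t
  by_cases htU : t ∈ U
  · calc _ = ‖(2 * (k : C(K₁, ℝ)) t - 1) • e - ((f₀ : C(K₁, E₁)) t - e)‖ := by
          congr 1
          module
      _ ≤ |2 * (k : C(K₁, ℝ)) t - 1| + ‖(f₀ : C(K₁, E₁)) t - e‖ := by
          rw [← hf₀.norm_smul_eq]
          exact norm_sub_le _ _
      _ ≤ 1 + ε := add_le_add (abs_le.2 ⟨by linarith, by linarith [hk.le_one t]⟩)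
          (hf₀.norm_apply_sub_le t htU)
      _ ≤ 1 + 3 * ε := by linarith [hk.pos]
  · calc _ = ‖(2 * (k : C(K₁, ℝ)) t) • e - (f₀ : C(K₁, E₁)) t‖ := by
          congr 1
          module
      _ ≤ |2 * (k : C(K₁, ℝ)) t| + ‖(f₀ : C(K₁, E₁)) t‖ := by
          rw [← hf₀.norm_smul_eq]
          exact norm_sub_le _ _
      _ ≤ 2 * ε + (1 + ε) := by
          rw [abs_of_nonneg (by positivity)]
          linarith [hk.lt_of_notMem t ht fun htO => htU (hO htO), hf₀.norm_apply_le t ht]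
      _ = 1 + 3 * ε := by ring

theorem norm_add_tensorCLM_sub_apply_le (hf₀ : IsPlateau f₀ e U ε) (hh : PeaksAt H h x U ε)
    (hk : PeaksAt H k z O ε) (hO : O ⊆ U ∩ {t | 1 - ε < (h : C(K₁, ℝ)) t}) {t : K₁}
    (ht : t ∈ choquetBoundary H) :
    ‖(↑(f₀ + (2 : ℝ) • (tensorCLM k e - tensorCLM h e)) : C(K₁, E₁)) t‖ ≤ 1 + 3 * ε := by
  change ‖(f₀ : C(K₁, E₁)) t
    + (2 : ℝ) • ((k : C(K₁, ℝ)) t • e - (h : C(K₁, ℝ)) t • e)‖ ≤ _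
  have hh0 := hh.nonneg t
  have hh1 := hh.le_one t
  have hk0 := hk.nonneg t
  have hk1 := hk.le_one t
  have hkO : t ∉ O → (k : C(K₁, ℝ)) t < ε := hk.lt_of_notMem t ht
  by_cases htU : t ∈ U
  · have hcoef : |1 - 2 * (h : C(K₁, ℝ)) t + 2 * (k : C(K₁, ℝ)) t| ≤ 1 + 2 * ε := by
      by_cases hth : 1 - ε < (h : C(K₁, ℝ)) t
      · exact abs_le.2 ⟨by linarith, by linarith⟩
      · have := hkO fun htO => hth (hO htO).2
        exact abs_le.2 ⟨by linarith, by linarith⟩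
    calc _ = ‖((f₀ : C(K₁, E₁)) t - e)
            + (1 - 2 * (h : C(K₁, ℝ)) t + 2 * (k : C(K₁, ℝ)) t) • e‖ := by
          congr 1
          module
      _ ≤ ε + (1 + 2 * ε) := by
          refine norm_add_le_of_le (hf₀.norm_apply_sub_le t htU) ?_
          rwa [hf₀.norm_smul_eq]
      _ = 1 + 3 * ε := by ring
  · have hcoef : |2 * (k : C(K₁, ℝ)) t - 2 * (h : C(K₁, ℝ)) t| ≤ 2 * ε := by
      have := hkO fun htO => htU (hO htO).1
      have := hh.lt_of_notMem t ht htU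
      exact abs_le.2 ⟨by linarith, by linarith⟩
    calc _ = ‖(f₀ : C(K₁, E₁)) t + (2 * (k : C(K₁, ℝ)) t - 2 * (h : C(K₁, ℝ)) t) • e‖ := by
          congr 1
          module
      _ ≤ (1 + ε) + 2 * ε := by
          refine norm_add_le_of_le (hf₀.norm_apply_le t ht) ?_
          rwa [hf₀.norm_smul_eq]
      _ = 1 + 3 * ε := by ring

theorem eventually_norm_add_sub_apply_le (hf₀ : IsPlateau f₀ e U ε) (hxU : x ∈ U) {f : H}
    (hf : f ∈ testFamily f₀ e x U ε) : ∀ᶠ O in (𝓝 x).smallSets, ∀ k : tensorSpace H,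
      PeaksAt H k x O ε → ∀ t ∈ choquetBoundary H,
        ‖(↑(f₀ + (2 : ℝ) • (tensorCLM k e - f)) : C(K₁, E₁)) t‖ ≤ 1 + 3 * ε := by
  have hU : U ∈ 𝓝 x := hf₀.isOpen.mem_nhds hxU
  obtain rfl | ⟨h, hh, rfl⟩ := hf
  · filter_upwards [eventually_smallSets_subset.2 hU] with O hO k hk t ht
    exact hf₀.norm_add_tensorCLM_sub_self_apply_le hk hO ht
  · have hnear : {t | 1 - ε < (h : C(K₁, ℝ)) t} ∈ 𝓝 x :=
      ((h : C(K₁, ℝ)).continuous.tendsto x).eventually_const_lt hh.lt_apply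
    filter_upwards [eventually_smallSets_subset.2 (inter_mem hU hnear)] with O hO k hk t ht
    exact hf₀.norm_add_tensorCLM_sub_apply_le hh hk hO ht

theorem lt_norm_add_tensorCLM (hf₀ : IsPlateau f₀ e U ε) (hxU : x ∈ U) (hk : PeaksAt H k x O ε) :
    3 - 3 * ε < ‖f₀ + (2 : ℝ) • tensorCLM k e‖ := by
  have hval : (1 + 2 * (k : C(K₁, ℝ)) x) • e
      = (f₀ + (2 : ℝ) • tensorCLM k e : H).1 x - ((f₀ : C(K₁, E₁)) x - e) := by
    change _ = (f₀ : C(K₁, E₁)) x + (2 : ℝ) • (k : C(K₁, ℝ)) x • e - ((f₀ : C(K₁, E₁)) x - e)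
    module
  have hle : |1 + 2 * (k : C(K₁, ℝ)) x| ≤ ‖f₀ + (2 : ℝ) • tensorCLM k e‖ + ε := by
    rw [← hf₀.norm_smul_eq, hval]
    exact norm_sub_le_of_le (ContinuousMap.norm_coe_le_norm _ x) (hf₀.norm_apply_sub_le x hxU)
  linarith [hk.lt_apply, le_abs_self (1 + 2 * (k : C(K₁, ℝ)) x)]

end IsPlateau

/-- Constants for which the argument works with an operator of norm `L`: its basic step compares
the lower bound `3 - 3 * ε` with the upper bound `L * (1 + 3 * ε) + 2 * δ` for a norm. -/
structure IsMargin (L δ ε : ℝ) : Prop where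
  pos_left : 0 < δ
  pos_right : 0 < ε
  lt_one : ε < 1
  add_lt : L * (1 + 3 * ε) + 2 * δ < 3 - 3 * ε

theorem exists_isMargin {L : ℝ} (hL0 : 0 ≤ L) (hL : L < 3) : ∃ δ ε, IsMargin L δ ε :=
  ⟨(3 - L) / 4, (3 - L) / 30, by linarith, by linarith, by linarith, by
    nlinarith [mul_pos (sub_pos.2 hL) (sub_pos.2 hL)]⟩

variable {δ ε : ℝ} {f₀ : H} {e : E₁} {U : Set K₁}

theorem exists_mem_largeSet_of_finite (hτ : BoundedBelowOn τ B) (hδε : IsMargin ‖τ‖ δ ε)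
    (hf₀ : IsPlateau f₀ e U ε) {x : K₁} (hx : x ∈ weakPeakPoints H) (hxU : x ∈ U) {F : Set H}
    (hFfin : F.Finite) (hF : F ⊆ testFamily f₀ e x U ε) : (B ∩ largeSet τ δ F).Nonempty := by
  by_contra hempty
  have hsmall : ∀ y ∈ B, ∃ f ∈ F, ‖τ f y‖ < δ := by
    simpa [Set.Nonempty, largeSet] using hempty
  have hε := hδε.pos_right
  obtain ⟨O, hOx, hO⟩ := eventually_smallSets.1 ((eventually_all_finite hFfin).2 fun f hf =>
    hf₀.eventually_norm_add_sub_apply_le hxU (hF hf))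
  obtain ⟨k, hk⟩ := exists_peaksAt hx hOx hε hδε.lt_one
  refine (hf₀.lt_norm_add_tensorCLM hxU hk).not_ge ((hτ _ _ ?_ fun y hy => ?_).trans hδε.add_lt.le)
  · have := hδε.pos_left
    positivity
  obtain ⟨f, hf, hfy⟩ := hsmall y hy
  calc ‖τ (f₀ + (2 : ℝ) • tensorCLM k e) y‖
      = ‖τ (f₀ + (2 : ℝ) • (tensorCLM k e - f)) y + (2 : ℝ) • τ f y‖ := by
        congr 1
        simp only [map_add, map_sub, map_smul, ContinuousMap.add_apply, ContinuousMap.sub_apply,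
          ContinuousMap.smul_apply]
        module
    _ ≤ ‖τ‖ * (1 + 3 * ε) + 2 * δ := by
        refine norm_add_le_of_le
          (norm_map_apply_le τ (by positivity) (hO O Subset.rfl f hf k hk) y) ?_
        rw [norm_smul_of_nonneg zero_le_two]
        linarith

end Operator

section Transfinite

variable {K₁ K₂ : Type u} {E₁ E₂ : Type*} [TopologicalSpace K₁] [CompactSpace K₁] [T2Space K₁]
  [TopologicalSpace K₂] [CompactSpace K₂]
  [NormedAddCommGroup E₁] [NormedSpace ℝ E₁]
  [NormedAddCommGroup E₂] [NormedSpace ℝ E₂] [CompleteSpace E₂]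
  {H : Submodule ℝ C(K₁, E₁)} {τ : H →L[ℝ] C(K₂, E₂)} {B : Set K₂}
  {δ ε : ℝ} {f₀ : H} {e : E₁} {U : Set K₁}

theorem infinite_inter_largeSet_of_accPt (hE₂ : ¬ ContainsC0 E₂) (hδ : 0 < δ) (hε : 0 < ε)
    (hε1 : ε < 1) {S : Set K₁} (hS : S ⊆ weakPeakPoints H) {x : K₁} (hx : AccPt x (𝓟 S))
    (hU : U ∈ 𝓝 x) {D : Set K₂}
    (hD : ∀ z ∈ S, z ∈ U → ∀ F ⊆ testFamily f₀ e z U ε, F.Finite → (D ∩ largeSet τ δ F).Nonempty)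
    {F : Set H} (hF : F ⊆ testFamily f₀ e x U ε) (hFfin : F.Finite) :
    (D ∩ largeSet τ δ F).Infinite := by
  intro hfin
  have hnear : {z | z ∈ interior U ∧ F ⊆ testFamily f₀ e z U ε} ∈ 𝓝 x :=
    inter_mem (interior_mem_nhds.2 hU)
      ((eventually_all_finite hFfin).2 fun f hf => eventually_mem_testFamily (hF hf))
  obtain ⟨z, h, hz, hlim⟩ := exists_seq_peaksAt_tendsto_zero hE₂ τ (hx.nhds_inter hnear)
    (inter_subset_right.trans hS) (U := fun _ => U)
    (fun z hz => mem_interior_iff_mem_nhds.1 hz.1.1) hε hε1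
  have hsmall : ∀ᶠ n in atTop, ∀ y ∈ D ∩ largeSet τ δ F, ‖τ (tensorCLM (h n) e) y‖ < δ :=
    (eventually_all_finite hfin).2 fun y _ => (hlim e y).norm.eventually_lt_const (by simpa)
  obtain ⟨n, hn⟩ := hsmall.exists
  obtain ⟨⟨⟨hzU, hzF⟩, hzS⟩, hpeak⟩ := hz n
  obtain ⟨y, hyD, hy⟩ := hD (z n) hzS (interior_subset hzU) (insert (tensorCLM (h n) e) F)
    (insert_subset (mem_insert_of_mem _ ⟨h n, hpeak, rfl⟩) hzF) (hFfin.insert _)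
  exact (hy _ (mem_insert _ _)).not_gt (hn y ⟨hyD, fun f hf => hy f (mem_insert_of_mem _ hf)⟩)

theorem inter_largeSet_nonempty_of_finite (hE₂ : ¬ ContainsC0 E₂) (hB : IsClosed B)
    (hτ : BoundedBelowOn τ B) (hδε : IsMargin ‖τ‖ δ ε) (hf₀ : IsPlateau f₀ e U ε) (α : Ordinal) :
    ∀ x ∈ iteratedDerivedSet (weakPeakPoints H) α, x ∈ U → ∀ F ⊆ testFamily f₀ e x U ε,
      F.Finite → (iteratedDerivedSet B α ∩ largeSet τ δ F).Nonempty := by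
  have hclosed : ∀ α F, IsClosed (iteratedDerivedSet B α ∩ largeSet τ δ F) := fun α F =>
    (isClosed_iteratedDerivedSet hB α).inter (isClosed_largeSet τ δ F)
  induction α using Ordinal.limitRecOn with
  | zero =>
    intro x hx hxU F hF hFfin
    rw [iteratedDerivedSet_zero] at hx ⊢
    exact exists_mem_largeSet_of_finite hτ hδε hf₀ hx hxU hFfin hF
  | add_one α ih =>
    intro x hx hxU F hF hFfin
    rw [iteratedDerivedSet_succ, relDerivedSet_apply] at hx ⊢
    have hinf := infinite_inter_largeSet_of_accPt hE₂ hδε.pos_left hδε.pos_right hδε.lt_one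
      (iteratedDerivedSet_subset _ α) hx.1 (hf₀.isOpen.mem_nhds hxU) ih hF hFfin
    obtain ⟨y, hyD, hy⟩ := hinf.exists_accPt_of_subset_isCompact (hclosed α F).isCompact Subset.rfl
    exact ⟨y, ⟨hy.mono (principal_mono.2 inter_subset_left), hyD.1⟩, hyD.2⟩
  | limit α hα ih =>
    intro x hx hxU F hF hFfin
    rw [iteratedDerivedSet_limit hα] at hx ⊢
    have : Nonempty (Iio α) := ⟨⟨0, hα.bot_lt⟩⟩
    rw [iInter_inter]
    exact IsCompact.nonempty_iInter_of_directed_nonempty_isCompact_isClosed _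
      (directed_of_isDirected_le fun b c hbc =>
        inter_subset_inter_left _ (iteratedDerivedSet_antitone B hbc))
      (fun b => ih b b.2 x (mem_iInter.1 hx b) hxU F hF hFfin)
      (fun b => (hclosed b F).isCompact) (fun b => hclosed b F)

theorem inter_largeSet_testFamily_nonempty (hE₂ : ¬ ContainsC0 E₂) (hB : IsClosed B)
    (hτ : BoundedBelowOn τ B) (hδε : IsMargin ‖τ‖ δ ε) (hf₀ : IsPlateau f₀ e U ε) {α : Ordinal}
    {x : K₁} (hx : x ∈ iteratedDerivedSet (weakPeakPoints H) α) (hxU : x ∈ U) :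
    (iteratedDerivedSet B α ∩ largeSet τ δ (testFamily f₀ e x U ε)).Nonempty :=
  inter_largeSet_nonempty_of_forall_finite (isClosed_iteratedDerivedSet hB α).isCompact
    (inter_largeSet_nonempty_of_finite hE₂ hB hτ hδε hf₀ α x hx hxU)

end Transfinite

section Plateau

variable {K E : Type*} [TopologicalSpace K] [CompactSpace K] [NormedAddCommGroup E]
  [NormedSpace ℝ E] {H : Submodule ℝ C(K, E)}

theorem exists_isPlateau {x : K} (hx : x ∈ weakPeakPoints H) {e : E} (he : ‖e‖ = 1) {ε : ℝ}
    (hε : 0 < ε) (hε1 : ε < 1) : ∃ (f : H) (U : Set K), x ∈ U ∧ IsPlateau f e U ε := by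
  obtain ⟨k, hk⟩ := exists_peaksAt hx univ_mem hε hε1
  refine ⟨tensorCLM k e, {t | 1 - ε < (k : C(K, ℝ)) t}, hk.lt_apply,
    isOpen_lt continuous_const (k : C(K, ℝ)).continuous, he, fun t _ => ?_, fun t ht => ?_⟩
  · rw [tensorCLM_apply, norm_smul, he, mul_one, Real.norm_of_nonneg (hk.nonneg t)]
    linarith [hk.le_one t]
  · have hsub : (tensorCLM k e : C(K, E)) t - e = ((k : C(K, ℝ)) t - 1) • e := by
      rw [tensorCLM_apply, sub_smul, one_smul]
    rw [hsub, norm_smul, he, mul_one, Real.norm_eq_abs, abs_le]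
    exact ⟨by linarith [show 1 - ε < (k : C(K, ℝ)) t from ht], by linarith [hk.le_one t]⟩

variable {ι : Type*} {p : ι → K} {V : ι → Set K} {h : ι → tensorSpace H} {v : ι → E}

theorem exists_peaksAt_pairwise_disjoint [Finite ι] [T2Space K] (hp : Function.Injective p)
    (hpW : ∀ i, p i ∈ weakPeakPoints H) {ε : ℝ} (hε : 0 < ε) (hε1 : ε < 1) :
    ∃ (V : ι → Set K) (h : ι → tensorSpace H), Pairwise (Function.onFun Disjoint V) ∧
      ∀ i, IsOpen (V i) ∧ p i ∈ V i ∧ PeaksAt H (h i) (p i) (V i) ε := by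
  obtain ⟨V, hV, hVdisj⟩ := (finite_range p).t2_separation
  choose h hh using fun i =>
    exists_peaksAt (hpW i) ((hV (p i)).2.mem_nhds (hV (p i)).1) hε hε1
  exact ⟨fun i => V (p i), h, fun i j hij =>
    hVdisj (mem_range_self i) (mem_range_self j) (hp.ne hij),
    fun i => ⟨(hV (p i)).2, (hV (p i)).1, hh i⟩⟩

variable [Fintype ι]

theorem norm_sum_tensorCLM_apply_sub_le {ε : ℝ} (hpW : ∀ i, p i ∈ weakPeakPoints H)
    (hV : Pairwise (Function.onFun Disjoint V))
    (hh : ∀ i, IsOpen (V i) ∧ p i ∈ V i ∧ PeaksAt H (h i) (p i) (V i) ε) (hv : ∀ i, ‖v i‖ ≤ 1)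
    (j : ι) : ‖(↑(∑ i, tensorCLM (h i) (v i)) : C(K, E)) (p j) - v j‖ ≤ ∑ _i : ι, ε := by
  classical
  have hsub : (↑(∑ i, tensorCLM (h i) (v i)) : C(K, E)) (p j) - v j
      = ∑ i, ((h i : C(K, ℝ)) (p j) - if i = j then 1 else 0) • v i := by
    simp only [sum_tensorCLM_apply, sub_smul, ite_smul, one_smul, zero_smul, Finset.sum_sub_distrib,
      Finset.sum_ite_eq', Finset.mem_univ, if_true]
  rw [hsub]
  refine norm_sum_le_of_le _ fun i _ => ?_
  rw [norm_smul, Real.norm_eq_abs]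
  refine (mul_le_of_le_one_right (abs_nonneg _) (hv i)).trans ?_
  obtain ⟨-, -, hpeak⟩ := hh i
  have hnonneg := hpeak.nonneg (p j)
  split_ifs with hij
  · subst hij
    exact abs_le.2 ⟨by linarith [hpeak.lt_apply], by linarith [hpeak.le_one (p i), hpeak.pos]⟩
  · have := hpeak.apply_le_of_disjoint (hpW j) (hh j).1 (hh j).2.1 (hV hij)
    exact abs_le.2 ⟨by linarith, by linarith⟩

theorem exists_isPlateau_sum_tensorCLM {ε ε' : ℝ} (hε : ∑ _i : ι, ε' < ε)
    (hpW : ∀ i, p i ∈ weakPeakPoints H) (hV : Pairwise (Function.onFun Disjoint V))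
    (hh : ∀ i, IsOpen (V i) ∧ p i ∈ V i ∧ PeaksAt H (h i) (p i) (V i) ε') (hv : ∀ i, ‖v i‖ ≤ 1)
    {j : ι} (hj : ‖v j‖ = 1) :
    ∃ U, p j ∈ U ∧ IsPlateau (∑ i, tensorCLM (h i) (v i)) (v j) U ε := by
  set g : H := ∑ i, tensorCLM (h i) (v i)
  refine ⟨{t | ‖(g : C(K, E)) t - v j‖ < ε},
    (norm_sum_tensorCLM_apply_sub_le hpW hV hh hv j).trans_lt hε,
    isOpen_lt ((g : C(K, E)).continuous.sub continuous_const).norm continuous_const, hj,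
    fun t ht => ?_, fun t ht => le_of_lt ht⟩
  have := norm_sum_tensorCLM_apply_le hV (fun i => (hh i).2.2) zero_le_one hv Finset.univ ht
  linarith

end Plateau

section Embedding

variable {K₁ K₂ : Type u} {E₁ E₂ : Type*} [TopologicalSpace K₁] [CompactSpace K₁] [T2Space K₁]
  [TopologicalSpace K₂] [CompactSpace K₂]
  [NormedAddCommGroup E₁] [NormedSpace ℝ E₁]
  [NormedAddCommGroup E₂] [NormedSpace ℝ E₂] [CompleteSpace E₂]
  {H : Submodule ℝ C(K₁, E₁)} {H₂ : Submodule ℝ C(K₂, E₂)} {τ : H →L[ℝ] C(K₂, E₂)} {B : Set K₂}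

theorem exists_mem_forall_peaksAt_le_norm (hE₂ : ¬ ContainsC0 E₂) (hB : IsClosed B)
    (hτ : BoundedBelowOn τ B) (hτH₂ : ∀ g, τ g ∈ H₂) {δ ε : ℝ} (hδε : IsMargin ‖τ‖ δ ε) {e : E₁}
    (he : ‖e‖ = 1) {α : Ordinal} {x : K₁} (hx : x ∈ iteratedDerivedSet (weakPeakPoints H) α) :
    ∃ y ∈ iteratedDerivedSet B α ∩ nonvanishingSet H₂, ∃ U ∈ 𝓝 x,
      ∀ h : tensorSpace H, PeaksAt H h x U ε → δ ≤ ‖τ (tensorCLM h e) y‖ := by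
  obtain ⟨f₀, U, hxU, hf₀⟩ :=
    exists_isPlateau (iteratedDerivedSet_subset _ _ hx) he hδε.pos_right hδε.lt_one
  obtain ⟨y, hyB, hy⟩ := inter_largeSet_testFamily_nonempty hE₂ hB hτ hδε hf₀ hx hxU
  exact ⟨y, ⟨hyB, τ f₀, hτH₂ f₀,
      norm_pos_iff.1 (hδε.pos_left.trans_le (hy f₀ (mem_insert _ _)))⟩,
    U, hf₀.isOpen.mem_nhds hxU, fun h hh => hy _ (mem_insert_of_mem _ ⟨h, hh, rfl⟩)⟩

theorem exists_map_finite_fibers [Nontrivial E₁] (hE₂ : ¬ ContainsC0 E₂) (hB : IsClosed B)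
    (hτ : BoundedBelowOn τ B) (hτ3 : ‖τ‖ < 3) (hτH₂ : ∀ g, τ g ∈ H₂) (α : Ordinal.{u}) :
    ∃ f : iteratedDerivedSet (weakPeakPoints H) α →
      ↥(iteratedDerivedSet B α ∩ nonvanishingSet H₂), ∀ y, (f ⁻¹' {y}).Finite := by
  obtain ⟨δ, ε, hδε⟩ := exists_isMargin (norm_nonneg τ) hτ3
  obtain ⟨e, he⟩ : ∃ e : E₁, ‖e‖ = 1 := exists_norm_eq E₁ zero_le_one
  choose f hf U hU hUf using fun x : iteratedDerivedSet (weakPeakPoints H) α =>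
    exists_mem_forall_peaksAt_le_norm hE₂ hB hτ hτH₂ hδε he x.2
  refine ⟨fun x => ⟨f x, hf x⟩, fun y => ?_⟩
  by_contra hinf
  set S : Set K₁ := Subtype.val '' ((fun x => (⟨f x, hf x⟩ :
    ↥(iteratedDerivedSet B α ∩ nonvanishingSet H₂))) ⁻¹' {y}) with hS
  have hlarge : ∀ z ∈ S, ∃ O ∈ 𝓝 z, ∀ h : tensorSpace H, PeaksAt H h z O ε →
      δ ≤ ‖τ (tensorCLM h e) y‖ := by
    rintro _ ⟨x, rfl, rfl⟩
    exact ⟨U x, hU x, hUf x⟩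
  choose! O hO hOy using hlarge
  obtain ⟨p, -, hp⟩ := (Set.Infinite.image Subtype.val_injective.injOn
    hinf : S.Infinite).exists_accPt_of_subset_isCompact isCompact_univ (subset_univ _)
  have hSW : S ⊆ weakPeakPoints H :=
    (Subtype.coe_image_subset _ _).trans (iteratedDerivedSet_subset _ α)
  obtain ⟨z, h, hz, hlim⟩ :=
    exists_seq_peaksAt_tendsto_zero hE₂ τ hp hSW hO hδε.pos_right hδε.lt_one
  obtain ⟨n, hn⟩ :=
    ((hlim e y).norm.eventually_lt_const (by simpa using hδε.pos_left)).exists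
  exact (hOy (z n) (hz n).1 (h n) (hz n).2).not_gt hn

theorem containsCopy_pi_of_finite (hE₂ : ¬ ContainsC0 E₂) (hB : IsClosed B)
    (hτ : BoundedBelowOn τ B) (hτ3 : ‖τ‖ < 3) (hτH₂ : ∀ g, τ g ∈ H₂) (α : Ordinal.{u})
    {ι κ : Type*} [Fintype ι] [Fintype κ] {p : ι → K₁} (hp : Function.Injective p)
    (hpW : ∀ i, p i ∈ iteratedDerivedSet (weakPeakPoints H) α) {q : κ → K₂}
    (hq : iteratedDerivedSet B α ∩ nonvanishingSet H₂ ⊆ range q) :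
    ContainsCopy (κ → E₂) (ι → E₁) := by
  obtain ⟨δ, ε, hδε⟩ := exists_isMargin (norm_nonneg τ) hτ3
  have hε := hδε.pos_right
  set ε' : ℝ := ε / (Fintype.card ι + 1) with hε'
  have hsum : ∑ _i : ι, ε' < ε := by
    rw [Finset.sum_const, Finset.card_univ, nsmul_eq_mul, hε', ← mul_div_assoc,
      div_lt_iff₀ (by positivity)]
    linarith
  have hε'1 : ε' < 1 :=
    (div_le_self hε.le (le_add_of_nonneg_left (Nat.cast_nonneg _))).trans_lt hδε.lt_one
  have hW : ∀ i, p i ∈ weakPeakPoints H := fun i => iteratedDerivedSet_subset _ _ (hpW i)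
  obtain ⟨V, h, hV, hh⟩ := exists_peaksAt_pairwise_disjoint hp hW (ε := ε') (by positivity) hε'1
  let G : (ι → E₁) →L[ℝ] H := ∑ i, tensorCLM (h i) ∘L ContinuousLinearMap.proj i
  have hG : ∀ v, G v = ∑ i, tensorCLM (h i) (v i) := fun v => by
    simp [G]
  refine containsCopy_of_le_norm
    (ContinuousLinearMap.pi fun j => ContinuousMap.evalCLM ℝ (q j) ∘L τ ∘L G) hδε.pos_left
    fun v hv => ?_
  obtain ⟨i, hi⟩ : ∃ i, ‖v i‖ = 1 := by
    by_contra! hne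
    have hlt : ‖v‖ < 1 := (pi_norm_lt_iff one_pos).2 fun i =>
      ((norm_le_pi_norm v i).trans_eq hv).lt_of_ne (hne i)
    exact hlt.ne hv
  obtain ⟨U, hiU, hplateau⟩ := exists_isPlateau_sum_tensorCLM hsum hW hV hh
    (fun i => (norm_le_pi_norm v i).trans_eq hv) hi
  rw [← hG] at hplateau
  obtain ⟨y, hyB, hy⟩ := inter_largeSet_testFamily_nonempty hE₂ hB hτ hδε hplateau (hpW i) hiU
  have hδy : δ ≤ ‖τ (G v) y‖ := hy _ (mem_insert _ _)
  obtain ⟨j, rfl⟩ := hq ⟨hyB, τ (G v), hτH₂ _, norm_pos_iff.1 (hδε.pos_left.trans_le hδy)⟩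
  exact hδy.trans (norm_le_pi_norm (fun j => τ (G v) (q j)) j)

end Embedding

theorem le_of_containsCopy_pi {E₁ E₂ : Type*} [NormedAddCommGroup E₁] [NormedSpace ℝ E₁]
    [Nontrivial E₁] [NormedAddCommGroup E₂] [NormedSpace ℝ E₂] [FiniteDimensional ℝ E₁]
    (e : E₁ ≃L[ℝ] E₂) {n m : ℕ} (h : ContainsCopy (Fin m → E₂) (Fin n → E₁)) : n ≤ m := by
  obtain ⟨M, ⟨S⟩⟩ := h
  have : FiniteDimensional ℝ E₂ := e.toLinearEquiv.finiteDimensional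
  have hrank : Module.finrank ℝ (Fin n → E₁) ≤ Module.finrank ℝ (Fin m → E₂) :=
    S.toLinearEquiv.finrank_eq.trans_le M.finrank_le
  simp only [Module.finrank_pi_fintype, Finset.sum_const, Finset.card_univ, Fintype.card_fin,
    smul_eq_mul, ← e.toLinearEquiv.finrank_eq] at hrank
  exact Nat.le_of_mul_le_mul_right hrank Module.finrank_pos

end VectorFunctionSpace

end

open VectorFunctionSpace in
theorem theorem1p1_general {K₁ K₂ : Type u} {E₁ : Type v} {E₂ : Type w}
    [TopologicalSpace K₁] [CompactSpace K₁] [T2Space K₁]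
    [TopologicalSpace K₂] [CompactSpace K₂]
    [NormedAddCommGroup E₁] [NormedSpace ℝ E₁] [Nontrivial E₁]
    [NormedAddCommGroup E₂] [NormedSpace ℝ E₂] [CompleteSpace E₂]
    {H₁ : Submodule ℝ C(K₁, E₁)} {H₂ : Submodule ℝ C(K₂, E₂)} (hE₂ : ¬ ContainsC0 E₂)
    {B : Set K₂} (hBclosed : IsClosed B) (hB : IsBoundary H₂ B)
    {M : Submodule ℝ C(K₂, E₂)} (hM : M ≤ H₂) (T : H₁ ≃L[ℝ] M)
    (hT : ‖(T : H₁ →L[ℝ] M)‖ * ‖(T.symm : M →L[ℝ] H₁)‖ < 3) (α : Ordinal.{u}) :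
    ((iteratedDerivedSet (weakPeakPoints H₁) α).Nonempty →
      (iteratedDerivedSet B α ∩ nonvanishingSet H₂).Nonempty) ∧
    ((iteratedDerivedSet B α ∩ nonvanishingSet H₂).Finite →
      (iteratedDerivedSet (weakPeakPoints H₁) α).Finite) ∧
    ((iteratedDerivedSet B α ∩ nonvanishingSet H₂).Finite →
      ∀ n m : ℕ, n = (iteratedDerivedSet (weakPeakPoints H₁) α).ncard →
        m = (iteratedDerivedSet B α ∩ nonvanishingSet H₂).ncard →
        ContainsCopy (Fin m → E₂) (Fin n → E₁) ∧
        (FiniteDimensional ℝ E₁ → Nonempty (E₁ ≃L[ℝ] E₂) → n ≤ m)) ∧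
    ((iteratedDerivedSet B α ∩ nonvanishingSet H₂).Infinite →
      #(iteratedDerivedSet (weakPeakPoints H₁) α) ≤
        #↥(iteratedDerivedSet B α ∩ nonvanishingSet H₂)) := by
  obtain ⟨τ, hτ3, hτ, hτH₂⟩ := exists_boundedBelowOn hB hM T hT
  obtain ⟨f, hf⟩ := exists_map_finite_fibers hE₂ hBclosed hτ hτ3 hτH₂ α
  have hfinite (h : (iteratedDerivedSet B α ∩ nonvanishingSet H₂).Finite) :
      (iteratedDerivedSet (weakPeakPoints H₁) α).Finite := by
    have := h.to_subtype
    exact finite_coe_iff.1 (finite_univ_iff.1 (finite_univ.preimage' fun y _ => hf y))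
  refine ⟨fun ⟨x, hx⟩ => ⟨f ⟨x, hx⟩, (f ⟨x, hx⟩).2⟩, hfinite, ?_, fun hinf => ?_⟩
  · rintro h n m rfl rfl
    have := h.to_subtype
    have := (hfinite h).to_subtype
    have hcopy : ContainsCopy (Fin (iteratedDerivedSet B α ∩ nonvanishingSet H₂).ncard → E₂)
        (Fin (iteratedDerivedSet (weakPeakPoints H₁) α).ncard → E₁) :=
      containsCopy_pi_of_finite hE₂ hBclosed hτ hτ3 hτH₂ α
        (Subtype.val_injective.comp (Finite.equivFin _).symm.injective) (fun i => Subtype.prop _)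
        (q := fun j => ((Finite.equivFin ↥(iteratedDerivedSet B α ∩ nonvanishingSet H₂)).symm j).1)
        fun y hy => ⟨Finite.equivFin _ ⟨y, hy⟩,
          congrArg Subtype.val (Equiv.symm_apply_apply _ _)⟩
    exact ⟨hcopy, fun _ ⟨e⟩ => le_of_containsCopy_pi e hcopy⟩
  · have := hinf.to_subtype
    refine (Cardinal.mk_le_mk_mul_of_mk_preimage_le (c := ℵ₀) f fun y => ?_).trans_eq ?_
    · exact (hf y).lt_aleph0.le
    · exact Cardinal.mul_aleph0_eq (Cardinal.aleph0_le_mk _)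

theorem theorem1p1 {K₁ K₂ : Type u} {E₁ : Type v} {E₂ : Type w}
    [TopologicalSpace K₁] [CompactSpace K₁] [T2Space K₁]
    [TopologicalSpace K₂] [CompactSpace K₂] [T2Space K₂]
    [NormedAddCommGroup E₁] [NormedSpace ℝ E₁] [CompleteSpace E₁] [Nontrivial E₁]
    [NormedAddCommGroup E₂] [NormedSpace ℝ E₂] [CompleteSpace E₂] [Nontrivial E₂]
    (H₁ : Submodule ℝ C(K₁, E₁)) (hH₁ : IsClosed (H₁ : Set C(K₁, E₁)))
    (H₂ : Submodule ℝ C(K₂, E₂)) (hH₂ : IsClosed (H₂ : Set C(K₂, E₂)))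
    (hE₂ : ¬ VectorFunctionSpace.ContainsC0 E₂)
    (B : Set K₂) (hBclosed : IsClosed B) (hB : VectorFunctionSpace.IsBoundary H₂ B)
    (M : Submodule ℝ C(K₂, E₂)) (hM : M ≤ H₂) (T : H₁ ≃L[ℝ] M)
    (hT : ‖(T : H₁ →L[ℝ] M)‖ * ‖(T.symm : M →L[ℝ] H₁)‖ < 3)
    (α : Ordinal.{u}) :
    ((iteratedDerivedSet (VectorFunctionSpace.weakPeakPoints H₁) α).Nonempty →
      (iteratedDerivedSet B α ∩ VectorFunctionSpace.nonvanishingSet H₂).Nonempty) ∧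
    ((iteratedDerivedSet B α ∩ VectorFunctionSpace.nonvanishingSet H₂).Finite →
      (iteratedDerivedSet (VectorFunctionSpace.weakPeakPoints H₁) α).Finite) ∧
    ((iteratedDerivedSet B α ∩ VectorFunctionSpace.nonvanishingSet H₂).Finite →
      ∀ n m : ℕ, n = (iteratedDerivedSet (VectorFunctionSpace.weakPeakPoints H₁) α).ncard →
        m = (iteratedDerivedSet B α ∩ VectorFunctionSpace.nonvanishingSet H₂).ncard →
        VectorFunctionSpace.ContainsCopy (Fin m → E₂) (Fin n → E₁) ∧
        (FiniteDimensional ℝ E₁ → Nonempty (E₁ ≃L[ℝ] E₂) → n ≤ m)) ∧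
    ((∀ e : E₁, ContinuousMap.const K₁ e ∈ H₁) →
      (iteratedDerivedSet B α ∩ VectorFunctionSpace.nonvanishingSet H₂).Infinite →
      #(iteratedDerivedSet (VectorFunctionSpace.weakPeakPoints H₁) α) ≤
        #↥(iteratedDerivedSet B α ∩ VectorFunctionSpace.nonvanishingSet H₂)) :=
  (theorem1p1_general hE₂ hBclosed hB hM T hT α).imp_right (.imp_right (.imp_right fun h _ => h))
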